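/- Let $0\le k\le n$ be integers, let $\mathcal S(\mathbb R^n)$ be the space of complex-valued Schwartz functions and $\mathcal S'(\mathbb R^n)$ the space of tempered distributions (continuous $\mathbb C$-linear functionals on $\mathcal S(\mathbb R^n)$) with the weak-* topology. For a Schwartz function $f$ let $T_f$ be the distribution $\langle T_f,\phi\rangle=\int f\phi$. For $g\in\mathcal S'(\mathbb R^k)$ let $g\otimes\delta^{n-k}\in\mathcal S'(\mathbb R^n)$ be the distribution $\langle g\otimes\delta^{n-k},\phi\rangle=\langle g,\phi(\cdot,0)\rangle$, and for $T\in\mathcal S'(\mathbb R^n)$ and an orthogonal matrix $U$ let $\langle T_U,\phi\rangle=\langle T,\phi(U^{T}\,\cdot)\rangle$. Put $$\mathcal G_k=\{(T_f\otimes\delta^{n-k})_U : f\in\mathcal S(\mathbb R^k),\ U^TU=I_n\},\qquad \mathcal G'_k=\{(f\otimes\delta^{n-k})_U : f\in\mathcal S'(\mathbb R^k),\ U^TU=I_n\}.$$ Let $M:\mathbb R^n\times\mathbb R^n\to\mathbb C$ satisfy the following conditions, where $O(M)[f](x)=\int_{\mathbb R^n}M(x,y)f(y)\,dy$: 1. for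 every $f\in L_2(\mathbb R^n)$ the integral $O(M)[f](x)$ converges absolutely for every $x$, and $O(M)[f]\in L_2(\mathbb R^n)$; 2. $M(y,x)=\overline{M(x,y)}$ for all $x,y$, and $\langle f,O(M)[f]\rangle_{L_2}>0$ for every nonzero $f\in L_2(\mathbb R^n)$; 3. $M(x,\cdot)$ and $M(\cdot,x)$ belong to $\mathcal S(\mathbb R^n)$ for every $x$, and $M$ is bounded; 4. the set of Schwartz functions that lie in the range of $O(M):L_2(\mathbb R^n)\to L_2(\mathbb R^n)$ is dense in $\mathcal S(\mathbb R^n)$. (Every proper kernel satisfies these conditions; a proper kernel is such an $M$ for which, in addition, for all multi-indices $\alpha,\beta$ one has $|x^\alpha\partial^x_\beta M(x,y)|<\gamma_{\alpha,\beta}(y)$ with some $\gamma_{\alpha,\beta}\in L_p(\mathbb R^n)$, $p\ge1$. So do the kernels $M(x,y)=\zeta(x-y)$ with $\zeta\in\mathcal S(\mathbb R^n)$, $\hat\zeta>0$.) For $f\in\mathcal S(\mathbb R^n)$ let $M_f$ be the real symmetric positive semidefinite $n\times n$ matrix with entries $$(M_f)_{ij}=\operatorname{Re}\iint_{\mathbb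 R^n\times\mathbb R^n}\overline{x_if(x)}\,M(x,y)\,y_jf(y)\,dx\,dy ,$$ let $R(f)=\|M_f\|_{n-k}$ be its Ky Fan $(n-k)$-anti-norm, that is, the sum of its $n-k$ smallest eigenvalues counted with multiplicity, and let $\Omega_\epsilon=\{f\in\mathcal S(\mathbb R^n): R(f)\le\epsilon\}$. **Theorem.** (i) For every $\epsilon>0$, $\mathcal G_k$ is contained in the weak-* sequential closure of $\{T_g: g\in\Omega_\epsilon\}$, i.e. every element of $\mathcal G_k$ is the weak-* limit of a sequence $T_{g_s}$ with $g_s\in\Omega_\epsilon$. (ii) If $(f_s)$ is a sequence in $\mathcal S(\mathbb R^n)$ and $T\in\mathcal S'(\mathbb R^n)$ are such that $T_{f_s}\to T$ weak-*, $R(f_s)\to0$ and $\operatorname{Tr}M_{f_s}$ is bounded, then $T\in\mathcal G'_k$. -/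

import Mathlib

open MeasureTheory Filter Topology
open scoped SchwartzMap ComplexConjugate ComplexOrder ENNReal

namespace LowDim

/-- Euclidean space `ℝⁿ`. -/
abbrev Rn (n : ℕ) : Type := EuclideanSpace ℝ (Fin n)

/-! ### Distributions carried by `k`-dimensional subspaces -/

/-- The isometric embedding `ℝᵏ → ℝⁿ`, `x ↦ (x, 0)`, for `k ≤ n`. -/
noncomputable def padZero {k n : ℕ} (hk : k ≤ n) : Rn k →ₗᵢ[ℝ] Rn n where
  toFun x := WithLp.toLp 2 fun i : Fin n => if h : (i : ℕ) < k then x ⟨i, h⟩ else 0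
  map_add' x y := by
    ext i
    by_cases h : (i : ℕ) < k <;> simp [h]
  map_smul' c x := by
    ext i
    by_cases h : (i : ℕ) < k <;> simp [h]
  norm_map' x := by
    obtain ⟨m, rfl⟩ := Nat.exists_eq_add_of_le hk
    simp [EuclideanSpace.norm_eq, Fin.sum_univ_add]

/-- Restriction of a Schwartz function to the first `k` coordinates:
`φ ↦ (x ↦ φ (x, 0))`. -/
noncomputable def restrictFirst {k n : ℕ} (hk : k ≤ n) : 𝓢(Rn n, ℂ) →L[ℂ] 𝓢(Rn k, ℂ) :=
  SchwartzMap.compCLMOfAntilipschitz ℂ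
    (padZero hk).toContinuousLinearMap.hasTemperateGrowth (padZero hk).isometry.antilipschitz

/-- The tensor product `g ⊗ δ^{n-k}` of `g ∈ 𝓢'(ℝᵏ)` with the Dirac distribution at the origin
of `ℝ^{n-k}`, that is `⟨g ⊗ δ^{n-k}, φ⟩ = ⟨g, φ(·, 0)⟩`. -/
noncomputable def tensorDelta {k n : ℕ} (hk : k ≤ n) (g : 𝓢'(Rn k, ℂ)) : 𝓢'(Rn n, ℂ) :=
  PointwiseConvergenceCLM.precomp ℂ (restrictFirst hk) g

theorem tensorDelta_apply {k n : ℕ} (hk : k ≤ n) (g : 𝓢'(Rn k, ℂ)) (φ : 𝓢(Rn n, ℂ)) :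
    tensorDelta hk g φ = g (restrictFirst hk φ) := rfl

theorem restrictFirst_apply {k n : ℕ} (hk : k ≤ n) (φ : 𝓢(Rn n, ℂ)) (x : Rn k) :
    restrictFirst hk φ x = φ (padZero hk x) := rfl

/-- The defining property of the tensor product: if `φ = φ₁ ⊗ φ₂` then
`⟨g ⊗ δ^{n-k}, φ⟩ = ⟨g, φ₁⟩ φ₂(0)`. -/
theorem tensorDelta_tmul {k m : ℕ} (g : 𝓢'(Rn k, ℂ)) (φ : 𝓢(Rn (k + m), ℂ))
    (φ₁ : 𝓢(Rn k, ℂ)) (φ₂ : 𝓢(Rn m, ℂ))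
    (hφ : ∀ x : Rn (k + m), φ x =
      φ₁ (WithLp.toLp 2 fun i => x (Fin.castAdd m i)) *
        φ₂ (WithLp.toLp 2 fun i => x (Fin.natAdd k i))) :
    tensorDelta (Nat.le_add_right k m) g φ = g φ₁ * φ₂ 0 := by
  have h : restrictFirst (Nat.le_add_right k m) φ = φ₂ 0 • φ₁ := by
    ext x
    rw [restrictFirst_apply, hφ]
    have h₁ : (WithLp.toLp 2 fun i => padZero (Nat.le_add_right k m) x (Fin.castAdd m i)) = x := by
      ext i; simp [padZero]
    have h₂ : (WithLp.toLp 2 fun i => padZero (Nat.le_add_right k m) x (Fin.natAdd k i)) =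
        (0 : Rn m) := by
      ext i; simp [padZero]
    rw [h₁, h₂]
    simp [mul_comm]
  rw [tensorDelta_apply, h, map_smul, smul_eq_mul, mul_comm]

/-- The orthogonal change of variables `g ↦ g_U`, `⟨g_U, φ⟩ = ⟨g, ψ⟩` with `ψ(x) = φ(Uᵀ x)`.
The orthogonal matrix `U` is given as a linear isometry of `ℝⁿ`, so `Uᵀ = U⁻¹ = U.symm`. -/
noncomputable def rotate {n : ℕ} (U : Rn n ≃ₗᵢ[ℝ] Rn n) (g : 𝓢'(Rn n, ℂ)) : 𝓢'(Rn n, ℂ) :=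
  PointwiseConvergenceCLM.precomp ℂ
    (SchwartzMap.compCLMOfContinuousLinearEquiv ℂ U.symm.toContinuousLinearEquiv) g

/-- The regular distribution `T_f`, `⟨T_f, φ⟩ = ∫ f φ`, of a Schwartz function `f`. -/
noncomputable def regular {n : ℕ} (f : 𝓢(Rn n, ℂ)) : 𝓢'(Rn n, ℂ) :=
  SchwartzMap.toTemperedDistributionCLM (Rn n) ℂ volume f

/-- `𝒢_k = {(T_f ⊗ δ^{n-k})_U | f ∈ 𝓢(ℝᵏ), U orthogonal}`. -/
def G {k n : ℕ} (hk : k ≤ n) : Set 𝓢'(Rn n, ℂ) :=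
  {T | ∃ (f : 𝓢(Rn k, ℂ)) (U : Rn n ≃ₗᵢ[ℝ] Rn n), T = rotate U (tensorDelta hk (regular f))}

/-- `𝒢'_k = {(f ⊗ δ^{n-k})_U | f ∈ 𝓢'(ℝᵏ), U orthogonal}`. -/
def G' {k n : ℕ} (hk : k ≤ n) : Set 𝓢'(Rn n, ℂ) :=
  {T | ∃ (f : 𝓢'(Rn k, ℂ)) (U : Rn n ≃ₗᵢ[ℝ] Rn n), T = rotate U (tensorDelta hk f)}

/-! ### Kernels -/

/-- The integral operator `O(M)[f](x) = ∫ M(x, y) f(y) dy`. -/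
noncomputable def integralOp {n : ℕ} (M : Rn n → Rn n → ℂ) (f : Rn n → ℂ) : Rn n → ℂ :=
  fun x => ∫ y, M x y * f y

/-- A kernel: `O(M)` is an everywhere defined operator on `L₂(ℝⁿ)`, `M` is conjugate symmetric,
and `⟨f, O(M)[f]⟩ > 0` for every nonzero `f ∈ L₂(ℝⁿ)`. -/
structure IsKernel {n : ℕ} (M : Rn n → Rn n → ℂ) : Prop where
  integrable : ∀ f : Rn n → ℂ, MemLp f 2 volume → ∀ x, Integrable (fun y => M x y * f y)
  memLp : ∀ f : Rn n → ℂ, MemLp f 2 volume → MemLp (integralOp M f) 2 volume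
  conj_symm : ∀ x y, M y x = conj (M x y)
  pos : ∀ f : Rn n → ℂ, MemLp f 2 volume → ¬ f =ᵐ[volume] 0 →
    0 < ∫ x, conj (f x) * integralOp M f x

/-- A kernel which is a Schwartz function of each variable, is bounded, and for which
`ℛ[O(M)] ∩ 𝓢(ℝⁿ)` is dense in `𝓢(ℝⁿ)`. -/
structure IsRegularKernel {n : ℕ} (M : Rn n → Rn n → ℂ) : Prop extends IsKernel M where
  schwartz_right : ∀ x, ∃ ψ : 𝓢(Rn n, ℂ), ∀ y, ψ y = M x y
  schwartz_left : ∀ y, ∃ ψ : 𝓢(Rn n, ℂ), ∀ x, ψ x = M x y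
  bounded : ∃ γ : ℝ, ∀ x y, ‖M x y‖ ≤ γ
  dense_range : Dense {ψ : 𝓢(Rn n, ℂ) |
    ∃ φ : Rn n → ℂ, MemLp φ 2 volume ∧ ψ =ᵐ[volume] integralOp M φ}

/-- The partial derivative `∂f/∂x_i`. -/
noncomputable def pderiv {n : ℕ} (i : Fin n) (f : Rn n → ℂ) : Rn n → ℂ :=
  fun x => fderiv ℝ f x (EuclideanSpace.single i 1)

/-- The partial derivative `∂_β f` for a multi-index `β`. -/
noncomputable def multiDeriv {n : ℕ} (β : Fin n → ℕ) (f : Rn n → ℂ) : Rn n → ℂ :=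
  (List.finRange n).foldr (fun i g => (pderiv i)^[β i] g) f

/-- A proper kernel: a regular kernel with in addition `|x^α ∂^x_β M(x, y)| < γ_{α,β}(y)` for some
`γ_{α,β} ∈ L_p(ℝⁿ)`, `p ≥ 1`. Proper kernels are a special case of regular kernels; the latter
also include the kernels `ζ(x - y)`, `ζ ∈ 𝓢(ℝⁿ)` with positive Fourier transform, which for `n ≥ 1`
do not satisfy the additional bound. -/
structure IsProperKernel {n : ℕ} (M : Rn n → Rn n → ℂ) : Prop extends IsRegularKernel M where
  decay : ∀ α β : Fin n → ℕ, ∃ (p : ℝ≥0∞) (γ : Rn n → ℝ), 1 ≤ p ∧ MemLp γ p volume ∧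
    ∀ x y, ‖((∏ i, x i ^ α i : ℝ) : ℂ) * multiDeriv β (fun x' => M x' y) x‖ < γ y

/-- `⟨f | M | g⟩ = ∬ f(x)^* M(x, y) g(y) dx dy`. -/
noncomputable def kernelForm {n : ℕ} (M : Rn n → Rn n → ℂ) (f g : Rn n → ℂ) : ℂ :=
  ∫ z : Rn n × Rn n, conj (f z.1) * M z.1 z.2 * g z.2

/-- The matrix `M_f = [Re ⟨x_i f | M | x_j f⟩]`. -/
noncomputable def gram {n : ℕ} (M : Rn n → Rn n → ℂ) (f : Rn n → ℂ) :
    Matrix (Fin n) (Fin n) ℝ :=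
  Matrix.of fun i j =>
    (kernelForm M (fun x => (x i : ℂ) * f x) (fun x => (x j : ℂ) * f x)).re

theorem gram_isHermitian {n : ℕ} {M : Rn n → Rn n → ℂ} (hM : IsKernel M) (f : Rn n → ℂ) :
    (gram M f).IsHermitian := by
  ext i j
  simp only [Matrix.conjTranspose_apply, gram, Matrix.of_apply, star_trivial, kernelForm]
  rw [← Complex.conj_re, ← integral_conj, Measure.volume_eq_prod, ← integral_prod_swap]
  congr 2
  ext z
  simp only [map_mul, Complex.conj_conj, Prod.fst_swap, Prod.snd_swap, ← hM.conj_symm]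
  ring

/-- The Ky Fan `m`-anti-norm: the sum of the `m` smallest eigenvalues, counted with multiplicity
(`hA.eigenvalues₀ 0 ≥ hA.eigenvalues₀ 1 ≥ …` lists the eigenvalues in decreasing order). -/
noncomputable def antiNorm {n : ℕ} (m : ℕ) {A : Matrix (Fin n) (Fin n) ℝ}
    (hA : A.IsHermitian) : ℝ :=
  ∑ i : Fin (Fintype.card (Fin n)), if n ≤ (i : ℕ) + m then hA.eigenvalues₀ i else 0

/-- `R(f) = ‖M_f‖_{n-k}`. -/
noncomputable def R {n : ℕ} (k : ℕ) {M : Rn n → Rn n → ℂ} (hM : IsKernel M)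
    (f : 𝓢(Rn n, ℂ)) : ℝ :=
  antiNorm (n - k) (gram_isHermitian hM f)

/-- `Ω_ε = {f ∈ 𝓢(ℝⁿ) | R(f) ≤ ε}`. -/
def Omega {n : ℕ} (k : ℕ) {M : Rn n → Rn n → ℂ} (hM : IsKernel M) (ε : ℝ) :
    Set 𝓢(Rn n, ℂ) :=
  {f | R k hM f ≤ ε}

end LowDim

namespace LowDim

/-! The quadratic form of `gram M f` at v is the energy ⟨h|M|h⟩ of h(x) = ⟨v, x⟩ f(x)
(`gram_quadratic`). A small anti-norm therefore says that ⟨v, ·⟩ f has small energy for n - k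
orthonormal directions v.

For (ii), take an eigenbasis of each matrix M_{f_s}. Its last n - k eigenvalues are nonnegative with
sum R(f_s) → 0, and by compactness the bases converge along a subsequence to an orthonormal basis B.
If ψ = O(M)[φ], Cauchy–Schwarz for the kernel bounds the pairing of ⟨v, ·⟩ f_s with the conjugate of
ψ by the energy of ⟨v, ·⟩ f_s times that of φ. Hence T kills ⟨B_j, ·⟩ψ for j ≥ k, first for
conjugates of such ψ and then for all ψ by density (`apply_innerMul_eq_zero_of_tendsto`). After a
rotation, Hadamard's lemma and a cutoff show that T sees only the restriction of a test function to
ℝᵏ (`exists_eq_tensorDelta`).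

For (i), thicken f to F = f ⊗ bump with a normalised bump and put f_s(x) = |det| F(D_s U x), where
D_s dilates the last n - k coordinates by s + 1. Dominated convergence gives the weak limit. In the
squeezed directions the L¹ norm of ⟨v, ·⟩ f_s is of order 1/(s + 1); since M is bounded, Ky Fan's
principle gives R(f_s) = O(s⁻²). -/

/-- A sesquilinear form which is real on the diagonal is Hermitian. -/
theorem hermitian_of_im_self_eq_zero {V : Type*} [AddCommGroup V] [Module ℂ V] (B : V → V → ℂ)
    (add_left : ∀ x y z, B (x + y) z = B x z + B y z)
    (add_right : ∀ x y z, B x (y + z) = B x y + B x z)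
    (smul_left : ∀ (c : ℂ) x y, B (c • x) y = conj c * B x y)
    (smul_right : ∀ (c : ℂ) x y, B x (c • y) = c * B x y)
    (h : ∀ x, (B x x).im = 0) (x y : V) : conj (B y x) = B x y := by
  -- Polarization: x + y compares the imaginary parts of B x y and B y x, and x + iy their real
  -- parts.
  have h₁ := h (x + y)
  have h₂ := h (x + Complex.I • y)
  simp only [add_left, add_right, smul_left, smul_right, Complex.add_im, Complex.mul_im,
    Complex.conj_I, Complex.neg_im, Complex.neg_re, Complex.I_re, Complex.I_im, h x, h y,
    Complex.mul_re] at h₁ h₂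
  apply Complex.ext <;> simp only [Complex.conj_re, Complex.conj_im] <;> linarith

/-- The space of square integrable functions on `ℝⁿ` (not identified almost everywhere). -/
def squareIntegrable (n : ℕ) : Submodule ℂ (Rn n → ℂ) where
  carrier := {f | MemLp f 2 volume}
  add_mem' hf hg := hf.add hg
  zero_mem' := MemLp.zero
  smul_mem' c _ hf := hf.const_smul c

/-- The sesquilinear form `⟨f, O(M)[g]⟩`. -/
noncomputable def kernelPairing {n : ℕ} (M : Rn n → Rn n → ℂ) (f g : Rn n → ℂ) : ℂ :=
  ∫ x, conj (f x) * integralOp M g x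

/-! ### The semi-inner product of a kernel and its Cauchy–Schwarz inequality -/

namespace IsKernel

variable {n : ℕ} {M : Rn n → Rn n → ℂ} (hM : IsKernel M)
include hM

theorem integralOp_add {f g : Rn n → ℂ} (hf : MemLp f 2 volume) (hg : MemLp g 2 volume) :
    integralOp M (f + g) = integralOp M f + integralOp M g := by
  ext x
  simp only [integralOp, Pi.add_apply, mul_add]
  exact integral_add (hM.integrable f hf x) (hM.integrable g hg x)

theorem integrable_conj_mul {f g : Rn n → ℂ} (hf : MemLp f 2 volume) (hg : MemLp g 2 volume) :
    Integrable fun x => conj (f x) * integralOp M g x :=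
  hf.star.integrable_mul (hM.memLp g hg)

theorem kernelPairing_add_left {f g h : Rn n → ℂ} (hf : MemLp f 2 volume) (hg : MemLp g 2 volume)
    (hh : MemLp h 2 volume) :
    kernelPairing M (f + g) h = kernelPairing M f h + kernelPairing M g h := by
  simp only [kernelPairing, Pi.add_apply, map_add, add_mul]
  exact integral_add (hM.integrable_conj_mul hf hh) (hM.integrable_conj_mul hg hh)

theorem kernelPairing_add_right {f g h : Rn n → ℂ} (hf : MemLp f 2 volume)
    (hg : MemLp g 2 volume) (hh : MemLp h 2 volume) :
    kernelPairing M f (g + h) = kernelPairing M f g + kernelPairing M f h := by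
  simp only [kernelPairing, hM.integralOp_add hg hh, Pi.add_apply, mul_add]
  exact integral_add (hM.integrable_conj_mul hf hg) (hM.integrable_conj_mul hf hh)

omit hM in
theorem kernelPairing_smul_left (c : ℂ) (f g : Rn n → ℂ) :
    kernelPairing M (c • f) g = conj c * kernelPairing M f g := by
  simp only [kernelPairing, Pi.smul_apply, smul_eq_mul, map_mul, mul_assoc]
  exact integral_const_mul _ _

omit hM in
theorem kernelPairing_smul_right (c : ℂ) (f g : Rn n → ℂ) :
    kernelPairing M f (c • g) = c * kernelPairing M f g := by
  simp only [kernelPairing, integralOp, Pi.smul_apply, smul_eq_mul, mul_left_comm _ c]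
  rw [← integral_const_mul]
  congr 1; ext x
  rw [integral_const_mul]; ring

theorem kernelPairing_self_nonneg {f : Rn n → ℂ} (hf : MemLp f 2 volume) :
    0 ≤ kernelPairing M f f := by
  by_cases h : f =ᵐ[volume] 0
  · have : kernelPairing M f f = 0 := by
      rw [kernelPairing]
      refine integral_eq_zero_of_ae ?_
      filter_upwards [h] with x hx
      simp [hx]
    exact this.ge
  · exact (hM.pos f hf h).le

/-- The positive semidefinite inner product given by a kernel. -/
noncomputable abbrev innerCore : PreInnerProductSpace.Core ℂ (squareIntegrable n) where
  inner f g := kernelPairing M f g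
  conj_inner_symm f g :=
    hermitian_of_im_self_eq_zero
      (fun f g : squareIntegrable n => kernelPairing M (f : Rn n → ℂ) (g : Rn n → ℂ))
      (fun f g h => hM.kernelPairing_add_left f.2 g.2 h.2)
      (fun f g h => hM.kernelPairing_add_right f.2 g.2 h.2)
      (fun c f g => kernelPairing_smul_left c (f : Rn n → ℂ) (g : Rn n → ℂ))
      (fun c f g => kernelPairing_smul_right c (f : Rn n → ℂ) (g : Rn n → ℂ))
      (fun f => (Complex.nonneg_iff.1 (hM.kernelPairing_self_nonneg f.2)).2.symm) f g
  re_inner_nonneg f := (Complex.nonneg_iff.1 (hM.kernelPairing_self_nonneg f.2)).1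
  add_left f g h := hM.kernelPairing_add_left f.2 g.2 h.2
  smul_left f g c := kernelPairing_smul_left c (f : Rn n → ℂ) (g : Rn n → ℂ)

/-- Cauchy–Schwarz needs only semidefiniteness, so it applies to functions without passing to
classes modulo null sets. -/
theorem norm_kernelPairing_sq_le {f g : Rn n → ℂ} (hf : MemLp f 2 volume)
    (hg : MemLp g 2 volume) :
    ‖kernelPairing M f g‖ ^ 2 ≤ (kernelPairing M f f).re * (kernelPairing M g g).re := by
  have h := @InnerProductSpace.Core.inner_mul_inner_self_le ℂ (squareIntegrable n) _ _ _
    hM.innerCore ⟨f, hf⟩ ⟨g, hg⟩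
  rw [@InnerProductSpace.Core.norm_inner_symm ℂ (squareIntegrable n) _ _ _
    hM.innerCore ⟨g, hg⟩ ⟨f, hf⟩, ← sq] at h
  exact h

end IsKernel

/-! ### The double integral ⟨f|M|g⟩ for integrable functions -/

namespace IsRegularKernel

variable {n : ℕ} {M : Rn n → Rn n → ℂ} (hM : IsRegularKernel M)
include hM

/-- `M` is a Carathéodory function: continuous in the first variable and measurable in the second,
hence jointly measurable. -/
theorem stronglyMeasurable_uncurry : StronglyMeasurable (Function.uncurry M) := by
  refine stronglyMeasurable_uncurry_of_continuous_of_stronglyMeasurable (fun y => ?_) fun x => ?_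
  · obtain ⟨ψ, hψ⟩ := hM.schwartz_left y
    rw [← show (ψ : Rn n → ℂ) = fun x => M x y from funext hψ]
    exact ψ.continuous
  · obtain ⟨ψ, hψ⟩ := hM.schwartz_right x
    rw [← show (ψ : Rn n → ℂ) = M x from funext hψ]
    exact ψ.continuous.stronglyMeasurable

theorem integrable_kernelForm {f g : Rn n → ℂ} (hf : Integrable f) (hg : Integrable g) :
    Integrable fun z : Rn n × Rn n => conj (f z.1) * M z.1 z.2 * g z.2 := by
  obtain ⟨γ, hγ⟩ := hM.bounded
  have hf' : Integrable fun x => conj (f x) :=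
    Complex.conjLIE.toContinuousLinearEquiv.integrable_comp_iff.2 hf
  have h := (Integrable.mul_prod hf' hg).bdd_mul
    (f := Function.uncurry M) (c := γ) hM.stronglyMeasurable_uncurry.aestronglyMeasurable
    (Eventually.of_forall fun z => hγ z.1 z.2)
  refine h.congr (Eventually.of_forall fun z => ?_)
  simp only [Function.uncurry]
  ring

/-- Fubini. This links the double integrals that define `gram` to the pairing for which
Cauchy–Schwarz is available. -/
theorem kernelForm_eq_kernelPairing {f g : Rn n → ℂ} (hf : Integrable f) (hg : Integrable g) :
    kernelForm M f g = kernelPairing M f g := by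
  rw [kernelForm, kernelPairing, Measure.volume_eq_prod,
    integral_prod _ (hM.integrable_kernelForm hf hg)]
  simp only [integralOp, mul_assoc, integral_const_mul]

omit hM in
-- A bound by L¹ norms is what part (i) needs, because these behave well under the dilations used
-- there.
theorem norm_kernelForm_le {γ : ℝ} (hγ : ∀ x y, ‖M x y‖ ≤ γ) {f g : Rn n → ℂ}
    (hf : Integrable f) (hg : Integrable g) :
    ‖kernelForm M f g‖ ≤ γ * ((∫ x, ‖f x‖) * ∫ x, ‖g x‖) := by
  have hint : Integrable fun z : Rn n × Rn n => γ * (‖f z.1‖ * ‖g z.2‖) :=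
    (Integrable.mul_prod hf.norm hg.norm).const_mul γ
  refine (norm_integral_le_of_norm_le hint (Eventually.of_forall fun z => ?_)).trans ?_
  · rw [norm_mul, norm_mul, RCLike.norm_conj, mul_right_comm, mul_comm γ]
    exact mul_le_mul_of_nonneg_left (hγ _ _) (by positivity)
  · rw [integral_const_mul, Measure.volume_eq_prod,
      integral_prod_mul (fun x => ‖f x‖) fun x => ‖g x‖]

end IsRegularKernel

/-! ### Linear multipliers and the quadratic form of the Gram matrix -/

/-- Multiplication of a Schwartz function by the linear function `⟨v, x⟩`. -/
noncomputable def innerMul {n : ℕ} (v : Rn n) : 𝓢(Rn n, ℂ) →L[ℂ] 𝓢(Rn n, ℂ) :=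
  SchwartzMap.smulLeftCLM ℂ fun x : Rn n => ((inner ℝ v x : ℝ) : ℂ)

theorem innerMul_apply {n : ℕ} (v : Rn n) (f : 𝓢(Rn n, ℂ)) (x : Rn n) :
    innerMul v f x = ((inner ℝ v x : ℝ) : ℂ) * f x := by
  rw [innerMul, SchwartzMap.smulLeftCLM_apply_apply (by fun_prop), smul_eq_mul]

theorem innerMul_eq_sum {n : ℕ} (v : Rn n) (f : 𝓢(Rn n, ℂ)) :
    innerMul v f = ∑ i, (v i : ℂ) • innerMul (EuclideanSpace.single i 1) f := by
  ext x
  rw [sum_apply]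
  simp only [innerMul_apply, smul_apply, smul_eq_mul,
    EuclideanSpace.inner_single_left, map_one, one_mul]
  rw [PiLp.inner_apply, Complex.ofReal_sum, Finset.sum_mul]
  refine Finset.sum_congr rfl fun i _ => ?_
  simp [mul_comm, mul_assoc]

/-- The quadratic form of the matrix `M_f` in the direction `v` is `⟨h | M | h⟩` for
`h(x) = ⟨v, x⟩ f(x)`. -/
theorem IsRegularKernel.gram_quadratic {n : ℕ} {M : Rn n → Rn n → ℂ} (hM : IsRegularKernel M)
    (f : 𝓢(Rn n, ℂ)) (v : Rn n) :
    v.ofLp ⬝ᵥ (gram M f).mulVec v.ofLp = (kernelForm M (innerMul v f) (innerMul v f)).re := by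
  have hlin : kernelForm M (innerMul v f) (innerMul v f) =
      ∑ i, ∑ j, ((v i * v j : ℝ) : ℂ) * kernelForm M (innerMul (EuclideanSpace.single i 1) f)
        (innerMul (EuclideanSpace.single j 1) f) := by
    simp only [kernelForm]
    simp_rw [← integral_const_mul]
    have hint : ∀ i j : Fin n, Integrable fun z : Rn n × Rn n => ((v i * v j : ℝ) : ℂ) *
        (conj (innerMul (EuclideanSpace.single i 1) f z.1) * M z.1 z.2 *
          innerMul (EuclideanSpace.single j 1) f z.2) := fun i j =>
      (hM.integrable_kernelForm (SchwartzMap.integrable _) (SchwartzMap.integrable _)).const_mul _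
    rw [Finset.sum_congr rfl fun i _ => (integral_finsetSum _ fun j _ => hint i j).symm,
      ← integral_finsetSum _ fun i _ => integrable_finsetSum _ fun j _ => hint i j]
    congr 1; ext z
    rw [innerMul_eq_sum v, sum_apply, sum_apply, map_sum,
      Finset.sum_mul, Finset.sum_mul]
    refine Finset.sum_congr rfl fun i _ => ?_
    rw [Finset.mul_sum]
    refine Finset.sum_congr rfl fun j _ => ?_
    simp only [smul_apply, smul_eq_mul, map_mul, Complex.conj_ofReal,
      Complex.ofReal_mul]
    ring
  rw [hlin]
  simp only [dotProduct, Matrix.mulVec, Complex.re_sum, Complex.re_ofReal_mul, Finset.mul_sum]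
  refine Finset.sum_congr rfl fun i _ => Finset.sum_congr rfl fun j _ => ?_
  have hco : ∀ i : Fin n, (fun x : Rn n => (x i : ℂ) * f x) =
      innerMul (EuclideanSpace.single i 1) f := fun i => by
    ext x
    rw [innerMul_apply, EuclideanSpace.inner_single_left, map_one, one_mul]
  rw [gram, Matrix.of_apply, hco, hco]
  ring

theorem IsRegularKernel.kernelForm_self_nonneg {n : ℕ} {M : Rn n → Rn n → ℂ}
    (hM : IsRegularKernel M) (f : 𝓢(Rn n, ℂ)) : 0 ≤ kernelForm M f f := by
  rw [hM.kernelForm_eq_kernelPairing f.integrable f.integrable]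
  exact hM.kernelPairing_self_nonneg (f.memLp 2)

/-! ### Eigenvalues and the Ky Fan anti-norm -/

/-- Mathlib's eigenbasis is indexed through an arbitrary equivalence with `Fin (card (Fin n))`.
Undoing it orders the basis by decreasing eigenvalue, so that the anti-norm becomes the tail sum
over j ≥ k. -/
theorem exists_antitone_eigenbasis {n : ℕ} {A : Matrix (Fin n) (Fin n) ℝ} (hA : A.IsHermitian) :
    ∃ (b : OrthonormalBasis (Fin n) ℝ (Rn n)) (l : Fin n → ℝ), Antitone l ∧
      (∀ j, A.mulVec (b j).ofLp = l j • (b j).ofLp) ∧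
      ∀ k, k ≤ n → antiNorm (n - k) hA = ∑ j : Fin n, if k ≤ (j : ℕ) then l j else 0 := by
  let c : Fin n ≃ Fin (Fintype.card (Fin n)) := finCongr (Fintype.card_fin n).symm
  let e : Fin (Fintype.card (Fin n)) ≃ Fin n := Fintype.equivOfCardEq (Fintype.card_fin _)
  refine ⟨hA.eigenvectorBasis.reindex (c.trans e).symm, fun j => hA.eigenvalues₀ (c j),
    fun i j hij => hA.eigenvalues₀_antitone (by simpa [c] using hij), fun j => ?_, fun k hk => ?_⟩
  · rw [OrthonormalBasis.reindex_apply, Equiv.symm_symm, hA.mulVec_eigenvectorBasis]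
    simp [Matrix.IsHermitian.eigenvalues, e]
  · rw [antiNorm, ← Equiv.sum_comp c]
    refine Finset.sum_congr rfl fun j _ => ?_
    have : n ≤ (c j : ℕ) + (n - k) ↔ k ≤ (j : ℕ) := by
      simp only [c, finCongr_apply, Fin.val_cast]; omega
    simp only [this]

theorem dotProduct_ofLp {n : ℕ} (u v : Rn n) : u.ofLp ⬝ᵥ v.ofLp = inner ℝ u v := by
  simp [PiLp.inner_apply, dotProduct, mul_comm]

theorem quadratic_eq_sum {n : ℕ} {A : Matrix (Fin n) (Fin n) ℝ}
    (b : OrthonormalBasis (Fin n) ℝ (Rn n)) (l : Fin n → ℝ)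
    (h : ∀ j, A.mulVec (b j).ofLp = l j • (b j).ofLp) (u : Rn n) :
    u.ofLp ⬝ᵥ A.mulVec u.ofLp = ∑ i, l i * inner ℝ (b i) u ^ 2 := by
  have hu : u.ofLp = ∑ i, inner ℝ (b i) u • (b i).ofLp := by
    conv_lhs => rw [← b.sum_repr' u]
    simp
  have hA : A.mulVec u.ofLp = ∑ i, inner ℝ (b i) u • l i • (b i).ofLp := by
    conv_lhs => rw [hu]
    rw [← Matrix.mulVecLin_apply, map_sum]
    simp [h]
  rw [hA, dotProduct_sum]
  refine Finset.sum_congr rfl fun i _ => ?_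
  rw [dotProduct_smul, dotProduct_smul, dotProduct_ofLp, real_inner_comm, smul_eq_mul, smul_eq_mul]
  ring

/-- A weighted sum of a decreasing sequence, with weights in `[0, 1]` of total mass `n - k`, is at
least the sum of the `n - k` last terms. -/
theorem sum_last_le_weighted_sum {n k : ℕ} {l c : Fin n → ℝ} (hl : Antitone l)
    (h0 : ∀ i, 0 ≤ c i) (h1 : ∀ i, c i ≤ 1)
    (hc : ∑ i, c i = ∑ i : Fin n, if k ≤ (i : ℕ) then (1 : ℝ) else 0) :
    (∑ i : Fin n, if k ≤ (i : ℕ) then l i else 0) ≤ ∑ i, l i * c i := by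
  by_cases hkn : k < n
  -- With l k as pivot, (l i - l k)(c i - 1_{k ≤ i}) ≥ 0: both factors change sign at k. Summing
  -- over i removes the pivot, as both weights have the same mass.
  · have key : ∀ i : Fin n, l ⟨k, hkn⟩ * (c i - if k ≤ (i : ℕ) then (1 : ℝ) else 0) ≤
        l i * c i - if k ≤ (i : ℕ) then l i else 0 := fun i => by
      by_cases hi : k ≤ (i : ℕ)
      · have := hl (show (⟨k, hkn⟩ : Fin n) ≤ i from hi)
        simp only [hi, if_true]
        nlinarith [h1 i]
      · have := hl (show i ≤ (⟨k, hkn⟩ : Fin n) from (not_le.1 hi).le)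
        simp only [hi, if_false]
        nlinarith [h0 i]
    have := Finset.sum_le_sum fun i (_ : i ∈ Finset.univ) => key i
    rw [← Finset.mul_sum, Finset.sum_sub_distrib, Finset.sum_sub_distrib, hc, sub_self,
      mul_zero] at this
    linarith
  · have hz : ∀ i : Fin n, ¬ k ≤ (i : ℕ) := fun i => by omega
    simp only [hz, if_false, Finset.sum_const_zero] at hc ⊢
    have := (Finset.sum_eq_zero_iff_of_nonneg fun i _ => h0 i).1 hc
    simp [fun i => this i (Finset.mem_univ i)]

/-- Ky Fan's principle: the sum of the `n - k` smallest eigenvalues is at most the trace of the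
quadratic form over any orthonormal family of `n - k` vectors. -/
theorem antiNorm_le_sum_quadratic {n k : ℕ} (hk : k ≤ n) {A : Matrix (Fin n) (Fin n) ℝ}
    (hA : A.IsHermitian) (u : OrthonormalBasis (Fin n) ℝ (Rn n)) :
    antiNorm (n - k) hA ≤
      ∑ j : Fin n, if k ≤ (j : ℕ) then (u j).ofLp ⬝ᵥ A.mulVec (u j).ofLp else 0 := by
  obtain ⟨b, l, hl, hb, han⟩ := exists_antitone_eigenbasis hA
  -- c i is the squared length of the projection of b i onto the span of the u j with j ≥ k.
  -- Parseval in u gives c i ≤ 1, and Parseval in b gives the total mass.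
  set c : Fin n → ℝ := fun i => ∑ j : Fin n, if k ≤ (j : ℕ) then inner ℝ (b i) (u j) ^ 2 else 0
  have hsum : (∑ j : Fin n, if k ≤ (j : ℕ) then (u j).ofLp ⬝ᵥ A.mulVec (u j).ofLp else 0) =
      ∑ i, l i * c i := by
    simp only [c, Finset.mul_sum, quadratic_eq_sum b l hb]
    rw [Finset.sum_comm]
    refine Finset.sum_congr rfl fun j _ => ?_
    split_ifs <;> simp
  rw [han k hk, hsum]
  refine sum_last_le_weighted_sum hl (fun i => ?_) (fun i => ?_) ?_
  · exact Finset.sum_nonneg fun j _ => by split_ifs <;> positivity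
  · calc c i ≤ ∑ j, inner ℝ (b i) (u j) ^ 2 :=
          Finset.sum_le_sum fun j _ => by split_ifs <;> [exact le_rfl; positivity]
      _ = 1 := by rw [u.sum_sq_inner_left]; simp
  · simp only [c]
    rw [Finset.sum_comm]
    refine Finset.sum_congr rfl fun j _ => ?_
    split_ifs
    · rw [b.sum_sq_inner_right]; simp
    · simp

/-- If `A` is positive semidefinite, some orthonormal basis has all but its first `k` vectors in
directions in which the quadratic form is nonnegative and at most the anti-norm. -/
theorem exists_basis_quadratic_le_antiNorm {n k : ℕ} (hk : k ≤ n) {A : Matrix (Fin n) (Fin n) ℝ}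
    (hA : A.IsHermitian) (hpos : ∀ v : Rn n, 0 ≤ v.ofLp ⬝ᵥ A.mulVec v.ofLp) :
    ∃ b : OrthonormalBasis (Fin n) ℝ (Rn n), ∀ j : Fin n, k ≤ (j : ℕ) →
      (b j).ofLp ⬝ᵥ A.mulVec (b j).ofLp ≤ antiNorm (n - k) hA := by
  obtain ⟨b, l, hl, hb, han⟩ := exists_antitone_eigenbasis hA
  have hq : ∀ j, (b j).ofLp ⬝ᵥ A.mulVec (b j).ofLp = l j := fun j => by
    rw [hb, dotProduct_smul, dotProduct_ofLp]; simp
  have hl0 : ∀ j, 0 ≤ l j := fun j => hq j ▸ hpos (b j)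
  refine ⟨b, fun j hj => ?_⟩
  rw [hq, han k hk]
  -- Semidefiniteness makes all terms of the tail sum nonnegative, so each is at most the sum.
  have := Finset.single_le_sum (f := fun j : Fin n => if k ≤ (j : ℕ) then l j else 0)
    (fun i _ => by split_ifs <;> [exact hl0 i; exact le_rfl]) (Finset.mem_univ j)
  simpa [hj] using this

/-! ### Tensor products of Schwartz functions -/

section Tensor

variable {D E₁ E₂ : Type*} [NormedAddCommGroup D] [NormedSpace ℝ D] [NormedAddCommGroup E₁]
  [NormedSpace ℝ E₁] [NormedAddCommGroup E₂] [NormedSpace ℝ E₂]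

theorem norm_iteratedFDeriv_comp_clm_le {F : Type*} [NormedAddCommGroup F] [NormedSpace ℝ F]
    {f : E₁ → F} (hf : ContDiff ℝ ((⊤ : ℕ∞) : WithTop ℕ∞) f) (P : D →L[ℝ] E₁) (i : ℕ) (x : D) :
    ‖iteratedFDeriv ℝ i (fun x => f (P x)) x‖ ≤ ‖iteratedFDeriv ℝ i f (P x)‖ * ‖P‖ ^ i := by
  have := P.iteratedFDeriv_comp_right hf x (i := i) (by exact_mod_cast le_top)
  rw [show (fun x => f (P x)) = f ∘ P from rfl, this]
  simpa using ContinuousMultilinearMap.norm_compContinuousLinearMap_le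
    (iteratedFDeriv ℝ i f (P x)) fun _ => P

/-- The map `f ↦ (x ↦ f (P x) * Γ (Q x))` for a Schwartz function `Γ` and linear maps `P`, `Q` that
jointly control the norm. -/
noncomputable def tensorCLM (P : D →L[ℝ] E₁) (Q : D →L[ℝ] E₂)
    (hPQ : ∀ x, ‖x‖ ≤ ‖P x‖ + ‖Q x‖) (Γ : 𝓢(E₂, ℂ)) : 𝓢(E₁, ℂ) →L[ℂ] 𝓢(D, ℂ) :=
  SchwartzMap.mkCLM (fun f x => f (P x) * Γ (Q x))
    (fun f g x => by simp [add_mul])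
    (fun a f x => by simp [mul_assoc])
    (fun f => ((f.smooth ⊤).comp P.contDiff).mul ((Γ.smooth ⊤).comp Q.contDiff))
    (by
      rintro ⟨K, N⟩
      refine ⟨Finset.Iic (K, N), ∑ i ∈ Finset.range (N + 1), (N.choose i : ℝ) *
        ((2 ^ K * ‖P‖ ^ i) * (2 ^ K * (Finset.Iic (K, N)).sup
          (fun m => SchwartzMap.seminorm ℂ m.1 m.2) Γ * ‖Q‖ ^ (N - i))), by positivity, ?_⟩
      intro f x
      -- The product form lets the weight ‖x‖ ^ K be split between the two factors, each absorbing
      -- its share by its own decay.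
      have hx : ‖x‖ ≤ (1 + ‖P x‖) * (1 + ‖Q x‖) := by
        nlinarith [hPQ x, norm_nonneg (P x), norm_nonneg (Q x),
          mul_nonneg (norm_nonneg (P x)) (norm_nonneg (Q x))]
      have hmul := norm_iteratedFDeriv_mul_le (n := N) (N := ((⊤ : ℕ∞) : WithTop ℕ∞))
        ((f.smooth ⊤).comp P.contDiff) ((Γ.smooth ⊤).comp Q.contDiff) x
        (by exact_mod_cast le_top)
      refine (mul_le_mul (pow_le_pow_left₀ (norm_nonneg x) hx K) hmul (norm_nonneg _)
        (by positivity)).trans ?_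
      rw [Finset.mul_sum, Finset.sum_mul]
      refine Finset.sum_le_sum fun i hi => ?_
      have hi' : i ≤ N := by simpa [Nat.lt_succ_iff] using hi
      have h₁ := norm_iteratedFDeriv_comp_clm_le (f.smooth ⊤) P i x
      have h₂ := norm_iteratedFDeriv_comp_clm_le (Γ.smooth ⊤) Q (N - i) x
      have h₃ := SchwartzMap.one_add_le_sup_seminorm_apply (𝕜 := ℂ) (m := (K, N)) (k := K) (n := i)
        le_rfl hi' f (P x)
      have h₄ := SchwartzMap.one_add_le_sup_seminorm_apply (𝕜 := ℂ) (m := (K, N)) (k := K)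
        (n := N - i) le_rfl (Nat.sub_le _ _) Γ (Q x)
      calc ((1 + ‖P x‖) * (1 + ‖Q x‖)) ^ K * ((N.choose i : ℝ) *
            ‖iteratedFDeriv ℝ i (fun x => f (P x)) x‖ *
              ‖iteratedFDeriv ℝ (N - i) (fun x => Γ (Q x)) x‖)
          ≤ ((1 + ‖P x‖) * (1 + ‖Q x‖)) ^ K * ((N.choose i : ℝ) *
            (‖iteratedFDeriv ℝ i f (P x)‖ * ‖P‖ ^ i) *
              (‖iteratedFDeriv ℝ (N - i) Γ (Q x)‖ * ‖Q‖ ^ (N - i))) := by gcongr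
        _ = (N.choose i : ℝ) * ((((1 + ‖P x‖) ^ K * ‖iteratedFDeriv ℝ i f (P x)‖) * ‖P‖ ^ i) *
              (((1 + ‖Q x‖) ^ K * ‖iteratedFDeriv ℝ (N - i) Γ (Q x)‖) * ‖Q‖ ^ (N - i))) := by
            rw [mul_pow]; ring
        _ ≤ (N.choose i : ℝ) * (((2 ^ K * (Finset.Iic (K, N)).sup
              (fun m => SchwartzMap.seminorm ℂ m.1 m.2) f) * ‖P‖ ^ i) *
              ((2 ^ K * (Finset.Iic (K, N)).sup
              (fun m => SchwartzMap.seminorm ℂ m.1 m.2) Γ) * ‖Q‖ ^ (N - i))) := by gcongr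
        _ = _ := by
            rw [show (schwartzSeminormFamily ℂ E₁ ℂ) =
              fun m => SchwartzMap.seminorm ℂ m.1 m.2 from rfl]
            ring)

end Tensor

/-! ### The splitting of `ℝⁿ` into the first `k` and the last `m` coordinates -/

section Split

variable {k m n : ℕ}

/-- The first `k` coordinates. -/
noncomputable def head (hk : k ≤ n) : Rn n →L[ℝ] Rn k :=
  LinearMap.toContinuousLinearMap
    { toFun := fun x => WithLp.toLp 2 fun i => x (Fin.castLE hk i)
      map_add' := fun _ _ => rfl
      map_smul' := fun _ _ => rfl }

/-- The last `m` coordinates. -/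
noncomputable def tail (h : k + m = n) : Rn n →L[ℝ] Rn m :=
  LinearMap.toContinuousLinearMap
    { toFun := fun x => WithLp.toLp 2 fun i => x (Fin.cast h (Fin.natAdd k i))
      map_add' := fun _ _ => rfl
      map_smul' := fun _ _ => rfl }

theorem head_apply (hk : k ≤ n) (x : Rn n) (i : Fin k) : head hk x i = x (Fin.castLE hk i) := rfl

theorem tail_apply (h : k + m = n) (x : Rn n) (i : Fin m) :
    tail h x i = x (Fin.cast h (Fin.natAdd k i)) := rfl

theorem padZero_apply (hk : k ≤ n) (x : Rn k) (i : Fin n) :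
    padZero hk x i = if h : (i : ℕ) < k then x ⟨i, h⟩ else 0 := rfl

theorem head_padZero (hk : k ≤ n) (x : Rn k) : head hk (padZero hk x) = x := by
  ext i
  simp [head_apply, padZero_apply]

theorem tail_padZero (h : k + m = n) (x : Rn k) :
    tail h (padZero (h ▸ Nat.le_add_right k m) x) = 0 := by
  ext i
  simp [tail_apply, padZero_apply]

theorem padZero_head_apply (hk : k ≤ n) (x : Rn n) (i : Fin n) :
    padZero hk (head hk x) i = if (i : ℕ) < k then x i else 0 := by
  rw [padZero_apply]
  split_ifs <;> rfl

theorem norm_sq_head_add_tail (h : k + m = n) (x : Rn n) :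
    ‖head (h ▸ Nat.le_add_right k m) x‖ ^ 2 + ‖tail h x‖ ^ 2 = ‖x‖ ^ 2 := by
  subst h
  simp only [EuclideanSpace.norm_sq_eq, Fin.sum_univ_add]
  rfl

theorem norm_le_head_add_tail (h : k + m = n) (x : Rn n) :
    ‖x‖ ≤ ‖head (h ▸ Nat.le_add_right k m) x‖ + ‖tail h x‖ := by
  have := norm_sq_head_add_tail h x
  refine le_of_sq_le_sq ?_ (by positivity)
  nlinarith [norm_nonneg (head (h ▸ Nat.le_add_right k m : k ≤ n) x), norm_nonneg (tail h x)]

/-- The isometric embedding `ℝⁿ → ℝᵏ × ℝᵐ` given by splitting coordinates. -/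
noncomputable def splitLI (h : k + m = n) : Rn n →ₗᵢ[ℝ] WithLp 2 (Rn k × Rn m) where
  toFun x := WithLp.toLp 2 (head (h ▸ Nat.le_add_right k m) x, tail h x)
  map_add' x y := by rw [map_add, map_add]; rfl
  map_smul' c x := by rw [map_smul, map_smul]; rfl
  norm_map' x := by
    rw [← sq_eq_sq₀ (norm_nonneg _) (norm_nonneg _), ← norm_sq_head_add_tail h x]
    exact WithLp.prod_norm_sq_eq_of_L2 _

/-- The isometry `ℝⁿ ≃ ℝᵏ × ℝᵐ` given by splitting coordinates. -/
noncomputable def splitIso (h : k + m = n) : Rn n ≃ₗᵢ[ℝ] WithLp 2 (Rn k × Rn m) :=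
  (splitLI h).toLinearIsometryEquiv <| by
    rw [(WithLp.linearEquiv 2 ℝ (Rn k × Rn m)).finrank_eq, Module.finrank_prod,
      finrank_euclideanSpace_fin, finrank_euclideanSpace_fin, finrank_euclideanSpace_fin, h]

/-- Splitting coordinates is an isometry onto the L² product, hence measure preserving, and Fubini
applies there. -/
theorem integral_head_mul_tail (h : k + m = n) (u : Rn k → ℂ) (v : Rn m → ℂ) :
    ∫ x : Rn n, u (head (h ▸ Nat.le_add_right k m) x) * v (tail h x) =
      (∫ x, u x) * ∫ y, v y := by
  rw [← integral_prod_mul u v, ← Measure.volume_eq_prod]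
  have h₁ := (WithLp.volume_preserving_ofLp (Rn k) (Rn m)).integral_comp
    (WithLp.homeomorphProd 2 (Rn k) (Rn m)).measurableEmbedding fun z => u z.1 * v z.2
  have h₂ := (splitIso h).measurePreserving.integral_comp
    (splitIso h).toHomeomorph.measurableEmbedding fun z => u z.ofLp.1 * v z.ofLp.2
  rw [← h₁, ← h₂]
  rfl

/-- A smooth cutoff function as a Schwartz function. -/
noncomputable def bump (n : ℕ) : 𝓢(Rn n, ℂ) :=
  HasCompactSupport.toSchwartzMap
    (f := fun x => (((⟨1, 2, one_pos, one_lt_two⟩ : ContDiffBump (0 : Rn n)) x : ℝ) : ℂ))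
    ((ContDiffBump.hasCompactSupport _).comp_left Complex.ofReal_zero)
    (Complex.ofRealCLM.contDiff.comp (ContDiffBump.contDiff _))

theorem bump_apply (n : ℕ) (x : Rn n) :
    bump n x = (((⟨1, 2, one_pos, one_lt_two⟩ : ContDiffBump (0 : Rn n)) x : ℝ) : ℂ) := rfl

theorem bump_zero (n : ℕ) : bump n 0 = 1 := by
  rw [bump_apply, ContDiffBump.one_of_mem_closedBall _ (by simp), Complex.ofReal_one]

theorem hasCompactSupport_bump (n : ℕ) : HasCompactSupport (bump n) := by
  rw [show (bump n : Rn n → ℂ) = _ from funext (bump_apply n)]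
  exact (ContDiffBump.hasCompactSupport _).comp_left (g := Complex.ofReal) Complex.ofReal_zero

theorem integral_bump_ne_zero (n : ℕ) : ∫ x, bump n x ≠ 0 := by
  simp only [bump_apply]
  rw [integral_complex_ofReal, Complex.ofReal_ne_zero]
  exact (ContDiffBump.integral_pos _).ne'

/-- A continuous right inverse of the restriction to the first `k` coordinates. -/
noncomputable def extend (h : k + m = n) : 𝓢(Rn k, ℂ) →L[ℂ] 𝓢(Rn n, ℂ) :=
  tensorCLM (head (h ▸ Nat.le_add_right k m)) (tail h) (norm_le_head_add_tail h) (bump m)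

theorem extend_apply (h : k + m = n) (f : 𝓢(Rn k, ℂ)) (x : Rn n) :
    extend h f x = f (head (h ▸ Nat.le_add_right k m) x) * bump m (tail h x) := rfl

theorem extend_padZero (h : k + m = n) (f : 𝓢(Rn k, ℂ)) (x : Rn k) :
    extend h f (padZero (h ▸ Nat.le_add_right k m) x) = f x := by
  rw [extend_apply, head_padZero, tail_padZero, bump_zero, mul_one]

end Split

/-! ### Smoothness of parametric integrals -/

/-- Differentiation under the integral, by induction on the order. `F` is generalized because the
derivative takes values in `E →L[ℝ] F`; keeping `E` and `F` in one universe allows this. -/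
theorem contDiff_nat_parametric_integral {E : Type} [NormedAddCommGroup E] [NormedSpace ℝ E]
    [ProperSpace E] (r : ℕ) {F : Type} [NormedAddCommGroup F] [NormedSpace ℝ F]
    {H : E × ℝ → F} (hH : ContDiff ℝ r H) :
    ContDiff ℝ r fun x => ∫ t in (0 : ℝ)..1, H (x, t) := by
  induction r generalizing F with
  | zero =>
    simp only [Nat.cast_zero, contDiff_zero] at hH ⊢
    exact intervalIntegral.continuous_parametric_intervalIntegral_of_continuous'
      (f := fun x t => H (x, t)) hH 0 1
  | succ r ih =>
    have hfd : ContDiff ℝ r fun p : E × ℝ =>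
        (fderiv ℝ H p).comp (ContinuousLinearMap.inl ℝ E ℝ) :=
      (hH.fderiv_right (by simp)).clm_comp contDiff_const
    rw [Nat.cast_succ, contDiff_succ_iff_hasFDerivAt]
    refine ⟨_, ih hfd, fun x => ?_⟩
    -- The dominating constant comes from compactness of the closed unit ball around x times [0, 1].
    obtain ⟨C, hC⟩ := ((isCompact_closedBall x 1).prod
      (isCompact_Icc (a := (0 : ℝ)) (b := 1))).exists_bound_of_continuousOn
        hfd.continuous.continuousOn
    have hcont : ∀ y : E, Continuous fun t : ℝ => H (y, t) := fun y =>
      hH.continuous.comp (by fun_prop)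
    have hcont' : Continuous fun t : ℝ =>
        (fderiv ℝ H (x, t)).comp (ContinuousLinearMap.inl ℝ E ℝ) :=
      hfd.continuous.comp (g := fun p : E × ℝ =>
        (fderiv ℝ H p).comp (ContinuousLinearMap.inl ℝ E ℝ)) (f := fun t : ℝ => (x, t))
        (by fun_prop)
    refine intervalIntegral.hasFDerivAt_integral_of_dominated_of_fderiv_le (𝕜 := ℝ)
      (F := fun x t => H (x, t)) (bound := fun _ => C)
      (Metric.closedBall_mem_nhds x one_pos)
      (Eventually.of_forall fun y => (hcont y).aestronglyMeasurable)
      ((hcont x).intervalIntegrable 0 1) hcont'.aestronglyMeasurable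
      (Eventually.of_forall fun t ht y hy => hC (y, t) ⟨hy, ?_⟩)
      intervalIntegrable_const (Eventually.of_forall fun t _ y _ => ?_)
    · rw [Set.uIoc_of_le zero_le_one] at ht
      exact ⟨ht.1.le, ht.2⟩
    · exact ((hH.differentiable (by simp)) (y, t)).hasFDerivAt.comp y
        (hasFDerivAt_prodMk_left y t)

theorem contDiff_parametric_integral {E : Type} [NormedAddCommGroup E] [NormedSpace ℝ E]
    [ProperSpace E] {F : Type} [NormedAddCommGroup F] [NormedSpace ℝ F]
    {H : E × ℝ → F} (hH : ContDiff ℝ ((⊤ : ℕ∞) : WithTop ℕ∞) H) :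
    ContDiff ℝ ((⊤ : ℕ∞) : WithTop ℕ∞) fun x => ∫ t in (0 : ℝ)..1, H (x, t) :=
  contDiff_infty.2 fun r => contDiff_nat_parametric_integral r (contDiff_infty.1 hH r)

/-! ### Cutting off Schwartz functions -/

/-- For i = 0 the mean value theorem between 0 and εx gives ε‖x‖; for i ≥ 1 the chain rule gives ε ^
i ≤ ε. -/
theorem norm_iteratedFDeriv_cutoff_sub_one_le {E : Type*} [NormedAddCommGroup E] [NormedSpace ℝ E]
    (χ : 𝓢(E, ℂ)) (h : χ 0 = 1) (i : ℕ) :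
    ∃ A : ℝ, 0 ≤ A ∧ ∀ ε : ℝ, 0 < ε → ε ≤ 1 → ∀ x : E,
      ‖iteratedFDeriv ℝ i (fun x => χ (ε • x) - 1) x‖ ≤ A * ε * (1 + ‖x‖) := by
  rcases Nat.eq_zero_or_pos i with rfl | hi
  · refine ⟨SchwartzMap.seminorm ℂ 0 1 χ, apply_nonneg _ _, fun ε hε _ x => ?_⟩
    rw [norm_iteratedFDeriv_zero, ← h]
    have := Convex.norm_image_sub_le_of_norm_fderiv_le (𝕜 := ℝ) (f := χ)
      (C := SchwartzMap.seminorm ℂ 0 1 χ) (s := Set.univ) (x := 0) (y := ε • x)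
      (fun y _ => χ.differentiableAt)
      (fun y _ => by
        rw [← norm_iteratedFDeriv_one]
        exact χ.norm_iteratedFDeriv_le_seminorm ℂ 1 y)
      convex_univ trivial trivial
    refine this.trans ?_
    rw [sub_zero, norm_smul, Real.norm_of_nonneg hε.le, mul_assoc]
    gcongr
    linarith
  · refine ⟨SchwartzMap.seminorm ℂ 0 i χ, apply_nonneg _ _, fun ε hε hε1 x => ?_⟩
    have hc : ContDiff ℝ i fun x : E => χ (ε • x) :=
      (χ.smooth i).comp (contDiff_const_smul ε)
    rw [fun_iteratedFDeriv_sub hc contDiff_const, iteratedFDeriv_const_of_ne hi.ne']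
    simp only [Pi.zero_apply, sub_zero]
    have h₁ := norm_iteratedFDeriv_comp_clm_le (χ.smooth ⊤) (ε • ContinuousLinearMap.id ℝ E) i x
    refine h₁.trans ?_
    -- Only an inequality: the identity of a trivial space has norm 0.
    have h₂ : ‖ε • ContinuousLinearMap.id ℝ E‖ ≤ ε := by
      rw [norm_smul, Real.norm_of_nonneg hε.le]
      exact mul_le_of_le_one_right hε.le ContinuousLinearMap.norm_id_le
    have h₃ : ‖ε • ContinuousLinearMap.id ℝ E‖ ^ i ≤ ε :=
      (pow_le_pow_left₀ (norm_nonneg _) h₂ i).trans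
        (pow_le_of_le_one hε.le hε1 hi.ne')
    calc _ ≤ SchwartzMap.seminorm ℂ 0 i χ * ε :=
          mul_le_mul (χ.norm_iteratedFDeriv_le_seminorm ℂ i _) h₃ (by positivity)
            (apply_nonneg _ _)
      _ ≤ _ := le_mul_of_one_le_right (mul_nonneg (apply_nonneg _ _) hε.le)
        (by linarith [norm_nonneg x])

theorem hasTemperateGrowth_comp_smul {E : Type*} [NormedAddCommGroup E] [NormedSpace ℝ E]
    (χ : 𝓢(E, ℂ)) (ε : ℝ) : Function.HasTemperateGrowth fun x : E => χ (ε • x) :=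
  χ.hasTemperateGrowth.comp (ε • ContinuousLinearMap.id ℝ E).hasTemperateGrowth

/-- Leibniz' rule. The growth 1 + ‖x‖ of the cutoff error costs one power of decay of φ, hence the
seminorms of order K + 1. -/
theorem seminorm_cutoff_sub_le {E : Type*} [NormedAddCommGroup E] [NormedSpace ℝ E]
    (χ : 𝓢(E, ℂ)) (h : χ 0 = 1) (φ : 𝓢(E, ℂ)) (K N : ℕ) :
    ∃ B : ℝ, ∀ ε : ℝ, 0 < ε → ε ≤ 1 → SchwartzMap.seminorm ℂ K N
      (SchwartzMap.smulLeftCLM ℂ (fun x : E => χ (ε • x)) φ - φ) ≤ B * ε := by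
  choose A hA0 hA using norm_iteratedFDeriv_cutoff_sub_one_le χ h
  set S := (Finset.Iic (K + 1, N)).sup (fun m => SchwartzMap.seminorm ℂ m.1 m.2) φ
  refine ⟨∑ i ∈ Finset.range (N + 1), (N.choose i : ℝ) * (A i * (2 ^ (K + 1) * S)),
    fun ε hε hε1 => ?_⟩
  refine SchwartzMap.seminorm_le_bound ℂ K N _
    (mul_nonneg (Finset.sum_nonneg fun i _ => by have := hA0 i; positivity) hε.le) fun x => ?_
  have heq : ((SchwartzMap.smulLeftCLM ℂ (fun x : E => χ (ε • x)) φ - φ : 𝓢(E, ℂ)) : E → ℂ) =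
      fun x => (χ (ε • x) - 1) * φ x := by
    ext y
    rw [sub_apply, SchwartzMap.smulLeftCLM_apply_apply (hasTemperateGrowth_comp_smul χ ε),
      smul_eq_mul]
    ring
  have hc : ContDiff ℝ ((⊤ : ℕ∞) : WithTop ℕ∞) fun x : E => χ (ε • x) - 1 :=
    ((χ.smooth ⊤).comp (contDiff_const_smul ε)).sub contDiff_const
  rw [heq]
  have hmul := norm_iteratedFDeriv_mul_le (n := N) hc (φ.smooth ⊤) x (by exact_mod_cast le_top)
  refine (mul_le_mul_of_nonneg_left hmul (by positivity)).trans ?_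
  rw [Finset.mul_sum, Finset.sum_mul]
  refine Finset.sum_le_sum fun i hi => ?_
  have h₃ := SchwartzMap.one_add_le_sup_seminorm_apply (𝕜 := ℂ) (m := (K + 1, N)) (k := K + 1)
    (n := N - i) le_rfl (Nat.sub_le _ _) φ x
  calc ‖x‖ ^ K * ((N.choose i : ℝ) * ‖iteratedFDeriv ℝ i (fun x => χ (ε • x) - 1) x‖ *
        ‖iteratedFDeriv ℝ (N - i) φ x‖)
      ≤ (1 + ‖x‖) ^ K * ((N.choose i : ℝ) * (A i * ε * (1 + ‖x‖)) *
        ‖iteratedFDeriv ℝ (N - i) φ x‖) := by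
        gcongr
        · linarith
        · exact hA i ε hε hε1 x
    _ = (N.choose i : ℝ) * (A i * ((1 + ‖x‖) ^ (K + 1) * ‖iteratedFDeriv ℝ (N - i) φ x‖)) * ε := by
        ring
    _ ≤ _ := by
        have := hA0 i
        gcongr

theorem tendsto_cutoff {E : Type*} [NormedAddCommGroup E] [NormedSpace ℝ E]
    (χ : 𝓢(E, ℂ)) (h : χ 0 = 1) (φ : 𝓢(E, ℂ)) :
    Tendsto (fun ε : ℝ => SchwartzMap.smulLeftCLM ℂ (fun x : E => χ (ε • x)) φ) (𝓝[>] 0)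
      (𝓝 φ) := by
  rw [(schwartz_withSeminorms ℂ E ℂ).tendsto_nhds]
  rintro ⟨K, N⟩ δ hδ
  obtain ⟨B, hB⟩ := seminorm_cutoff_sub_le χ h φ K N
  have hlim : Tendsto (fun ε : ℝ => B * ε) (𝓝[>] 0) (𝓝 0) := by
    have : Tendsto (fun ε : ℝ => B * ε) (𝓝 0) (𝓝 (B * 0)) := by
      exact (continuous_const.mul continuous_id).tendsto 0
    rw [mul_zero] at this
    exact this.mono_left nhdsWithin_le_nhds
  filter_upwards [hlim.eventually_lt_const hδ, self_mem_nhdsWithin,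
    nhdsWithin_le_nhds (Iio_mem_nhds one_pos)] with ε h₁ h₂ h₃
  exact (hB ε h₂ (le_of_lt h₃)).trans_lt h₁

/-! ### Tempered distributions annihilated by coordinate functions -/

section Structure

variable {k n : ℕ}

/-- The coefficients in Hadamard's lemma. -/
noncomputable def hadamardCoeff (hk : k ≤ n) (φ : 𝓢(Rn n, ℂ)) (j : Fin n) (x : Rn n) : ℂ :=
  ∫ t in (0 : ℝ)..1, fderiv ℝ φ (padZero hk (head hk x) + t • (x - padZero hk (head hk x)))
    (EuclideanSpace.single j 1)

theorem contDiff_hadamardCoeff (hk : k ≤ n) (φ : 𝓢(Rn n, ℂ)) (j : Fin n) :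
    ContDiff ℝ ((⊤ : ℕ∞) : WithTop ℕ∞) (hadamardCoeff hk φ j) := by
  have hP : ContDiff ℝ ((⊤ : ℕ∞) : WithTop ℕ∞) fun x : Rn n => padZero hk (head hk x) :=
    (padZero hk).contDiff.comp (head hk).contDiff
  refine contDiff_parametric_integral (H := fun p : Rn n × ℝ => fderiv ℝ φ
    (padZero hk (head hk p.1) + p.2 • (p.1 - padZero hk (head hk p.1)))
    (EuclideanSpace.single j 1)) ?_
  have h₁ : ContDiff ℝ ((⊤ : ℕ∞) : WithTop ℕ∞) (fderiv ℝ φ) :=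
    (φ.smooth ⊤).fderiv_right (by simp)
  have h₂ : ContDiff ℝ ((⊤ : ℕ∞) : WithTop ℕ∞) fun p : Rn n × ℝ =>
      padZero hk (head hk p.1) + p.2 • (p.1 - padZero hk (head hk p.1)) :=
    (hP.comp contDiff_fst).add (contDiff_snd.smul (contDiff_fst.sub (hP.comp contDiff_fst)))
  exact (h₁.comp h₂).clm_apply contDiff_const

theorem sub_padZero_head (hk : k ≤ n) (x : Rn n) :
    x - padZero hk (head hk x) =
      ∑ j : Fin n, (if k ≤ (j : ℕ) then x j else 0) • EuclideanSpace.single j (1 : ℝ) := by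
  ext i
  simp only [PiLp.sub_apply, padZero_head_apply, WithLp.ofLp_sum, Finset.sum_apply,
    PiLp.smul_apply, PiLp.single_apply, smul_eq_mul, mul_ite, mul_one, mul_zero,
    Finset.sum_ite_eq, Finset.mem_univ, if_true]
  by_cases h : k ≤ (i : ℕ)
  · simp [h, not_lt.2 h]
  · simp [h, not_le.1 h]

/-- Hadamard's lemma: integrate the derivative of φ along the segment from the projection of x onto
ℝᵏ, where φ vanishes, to x. -/
theorem eq_sum_hadamardCoeff (hk : k ≤ n) (φ : 𝓢(Rn n, ℂ)) (hφ : restrictFirst hk φ = 0)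
    (x : Rn n) :
    φ x = ∑ j : Fin n, if k ≤ (j : ℕ) then (x j : ℂ) * hadamardCoeff hk φ j x else 0 := by
  set p := padZero hk (head hk x)
  set q := x - p with hq
  have hd : ∀ t : ℝ, HasDerivAt (fun t : ℝ => φ (p + t • q)) (fderiv ℝ φ (p + t • q) q) t :=
    fun t => (φ.hasFDerivAt _).comp_hasDerivAt t (by
      simpa using ((hasDerivAt_id t).smul_const q).const_add p)
  have hcont : ∀ v, Continuous fun t : ℝ => fderiv ℝ φ (p + t • q) v := fun v =>
    (((φ.smooth 1).continuous_fderiv (by simp)).comp (by fun_prop)).clm_apply continuous_const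
  have h0 : φ p = 0 := by
    rw [← restrictFirst_apply, hφ]; rfl
  have h1 := intervalIntegral.integral_eq_sub_of_hasDerivAt (a := 0) (b := 1)
    (fun t _ => hd t) ((hcont q).intervalIntegrable 0 1)
  rw [one_smul, zero_smul, add_zero, h0, sub_zero, hq, add_sub_cancel, ← hq] at h1
  rw [← h1]
  have hsum : ∀ L : Rn n →L[ℝ] ℂ, L q = ∑ j : Fin n,
      ((if k ≤ (j : ℕ) then x j else 0 : ℝ) : ℂ) * L (EuclideanSpace.single j 1) := fun L => by
    rw [show q = _ from sub_padZero_head hk x, map_sum]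
    simp only [map_smul, Complex.real_smul]
  simp_rw [hsum]
  rw [intervalIntegral.integral_finsetSum fun j _ =>
    ((hcont _).intervalIntegrable 0 1).const_mul _]
  refine Finset.sum_congr rfl fun j _ => ?_
  rw [intervalIntegral.integral_const_mul]
  split_ifs <;> simp [hadamardCoeff, p, q]

/-- The Hadamard coefficients are smooth but need not be Schwartz. Multiplied by a cutoff they
become test functions; `T` kills the cut-off φ, and continuity removes the cutoff. -/
theorem apply_eq_zero_of_restrictFirst_eq_zero (hk : k ≤ n) (T : 𝓢'(Rn n, ℂ))
    (hT : ∀ j : Fin n, k ≤ (j : ℕ) → ∀ ψ, T (innerMul (EuclideanSpace.single j 1) ψ) = 0)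
    (φ : 𝓢(Rn n, ℂ)) (hφ : restrictFirst hk φ = 0) : T φ = 0 := by
  have hz : ∀ ε : ℝ, 0 < ε →
      T (SchwartzMap.smulLeftCLM ℂ (fun x : Rn n => bump n (ε • x)) φ) = 0 := fun ε hε => by
    have hs : ∀ j, HasCompactSupport fun x => bump n (ε • x) * hadamardCoeff hk φ j x :=
      fun j => ((hasCompactSupport_bump n).comp_homeomorph
        (Homeomorph.smulOfNeZero ε hε.ne')).mul_right
    have hc : ∀ j, ContDiff ℝ ((⊤ : ℕ∞) : WithTop ℕ∞)
        fun x => bump n (ε • x) * hadamardCoeff hk φ j x := fun j =>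
      (((bump n).smooth ⊤).comp (contDiff_const_smul ε)).mul (contDiff_hadamardCoeff hk φ j)
    have : SchwartzMap.smulLeftCLM ℂ (fun x : Rn n => bump n (ε • x)) φ =
        ∑ j : Fin n, if k ≤ (j : ℕ) then
          innerMul (EuclideanSpace.single j 1) ((hs j).toSchwartzMap (hc j)) else 0 := by
      ext x
      rw [SchwartzMap.smulLeftCLM_apply_apply (hasTemperateGrowth_comp_smul _ ε), smul_eq_mul,
        eq_sum_hadamardCoeff hk φ hφ, sum_apply, Finset.mul_sum]
      refine Finset.sum_congr rfl fun j _ => ?_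
      split_ifs
      · rw [innerMul_apply, EuclideanSpace.inner_single_left, map_one, one_mul]
        change _ = (x j : ℂ) * (bump n (ε • x) * hadamardCoeff hk φ j x)
        ring
      · simp
    rw [this, map_sum]
    refine Finset.sum_eq_zero fun j _ => ?_
    split_ifs with hj
    · exact hT j hj _
    · exact map_zero T
  have h₁ := (T.continuous.tendsto φ).comp (tendsto_cutoff (bump n) (bump_zero n) φ)
  refine tendsto_nhds_unique h₁ (tendsto_const_nhds.congr' ?_)
  filter_upwards [self_mem_nhdsWithin] with ε hε
  exact (hz ε hε).symm

/-- A tempered distribution annihilated by the last coordinate functions is the tensor product of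
a tempered distribution in the first coordinates and a Dirac distribution. -/
theorem exists_eq_tensorDelta (hk : k ≤ n) (T : 𝓢'(Rn n, ℂ))
    (hT : ∀ j : Fin n, k ≤ (j : ℕ) → ∀ ψ, T (innerMul (EuclideanSpace.single j 1) ψ) = 0) :
    ∃ g : 𝓢'(Rn k, ℂ), T = tensorDelta hk g := by
  have h : k + (n - k) = n := Nat.add_sub_cancel' hk
  -- g is `T` composed with a right inverse of the restriction; φ and the extension of its
  -- restriction agree on ℝᵏ.
  refine ⟨PointwiseConvergenceCLM.precomp ℂ (extend h) T, ?_⟩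
  ext φ
  rw [tensorDelta_apply]
  change T φ = T (extend h (restrictFirst hk φ))
  rw [← sub_eq_zero, ← map_sub]
  refine apply_eq_zero_of_restrictFirst_eq_zero hk T hT _ ?_
  ext x
  rw [map_sub, sub_apply, restrictFirst_apply, restrictFirst_apply, extend_padZero,
    restrictFirst_apply, sub_self]
  rfl

end Structure

theorem regular_apply {n : ℕ} (f φ : 𝓢(Rn n, ℂ)) : regular f φ = ∫ x, φ x * f x :=
  SchwartzMap.toTemperedDistributionCLM_apply_apply volume f φ

theorem rotate_apply {n : ℕ} (U : Rn n ≃ₗᵢ[ℝ] Rn n) (T : 𝓢'(Rn n, ℂ)) (φ : 𝓢(Rn n, ℂ)) :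
    rotate U T φ =
      T (SchwartzMap.compCLMOfContinuousLinearEquiv ℂ U.symm.toContinuousLinearEquiv φ) := rfl

/-! ### Limits of Schwartz functions with vanishing anti-norm -/

section Limit

variable {n : ℕ}

/-- Complex conjugation of Schwartz functions. -/
noncomputable def conjSchwartz (n : ℕ) : 𝓢(Rn n, ℂ) →L[ℝ] 𝓢(Rn n, ℂ) :=
  SchwartzMap.postcompCLM (𝕜 := ℝ) (Complex.conjCLE : ℂ →L[ℝ] ℂ)

theorem conjSchwartz_apply (ψ : 𝓢(Rn n, ℂ)) (x : Rn n) : conjSchwartz n ψ x = conj (ψ x) := rfl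

theorem conjSchwartz_conjSchwartz (ψ : 𝓢(Rn n, ℂ)) : conjSchwartz n (conjSchwartz n ψ) = ψ := by
  ext x
  rw [conjSchwartz_apply, conjSchwartz_apply, Complex.conj_conj]

/-- The distributional pairing is bilinear and the kernel pairing sesquilinear, which is why
conjugates appear. -/
theorem regular_innerMul_conj (M : Rn n → Rn n → ℂ) (f ψ : 𝓢(Rn n, ℂ)) (v : Rn n)
    {φ : Rn n → ℂ} (hψ : ψ =ᵐ[volume] integralOp M φ) :
    regular f (innerMul v (conjSchwartz n ψ)) = conj (kernelPairing M (innerMul v f) φ) := by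
  rw [regular_apply, kernelPairing, ← integral_conj]
  refine integral_congr_ae ?_
  filter_upwards [hψ] with x hx
  rw [← hx, innerMul_apply, innerMul_apply, conjSchwartz_apply]
  simp only [map_mul, Complex.conj_ofReal, Complex.conj_conj]
  ring

theorem IsRegularKernel.quadratic_nonneg {M : Rn n → Rn n → ℂ} (hM : IsRegularKernel M)
    (f : 𝓢(Rn n, ℂ)) (v : Rn n) : 0 ≤ v.ofLp ⬝ᵥ (gram M f).mulVec v.ofLp := by
  rw [hM.gram_quadratic]
  exact (Complex.nonneg_iff.1 (hM.kernelForm_self_nonneg _)).1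

/-- Weak convergence may be tested on products with convergent linear functions. -/
theorem tendsto_regular_innerMul {ι : Type*} {l : Filter ι} {f : ι → 𝓢(Rn n, ℂ)}
    {T : 𝓢'(Rn n, ℂ)} (hf : Tendsto (fun s => regular (f s)) l (𝓝 T)) {v : ι → Rn n} {w : Rn n}
    (hv : Tendsto v l (𝓝 w)) (ψ : 𝓢(Rn n, ℂ)) :
    Tendsto (fun s => regular (f s) (innerMul (v s) ψ)) l (𝓝 (T (innerMul w ψ))) := by
  rw [PointwiseConvergenceCLM.tendsto_iff_forall_tendsto] at hf
  have hlin : ∀ (S : 𝓢'(Rn n, ℂ)) (u : Rn n), S (innerMul u ψ) =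
      ∑ i, (u i : ℂ) * S (innerMul (EuclideanSpace.single i 1) ψ) := fun S u => by
    rw [innerMul_eq_sum, map_sum]
    simp only [map_smul, smul_eq_mul]
  rw [hlin T w]
  refine Tendsto.congr (fun s => (hlin (regular (f s)) (v s)).symm) ?_
  refine tendsto_finsetSum _ fun i _ => Tendsto.mul ?_ (hf _)
  exact ((Complex.continuous_ofReal.comp (EuclideanSpace.proj i).continuous).tendsto w).comp hv

theorem apply_innerMul_eq_zero_of_tendsto {M : Rn n → Rn n → ℂ} (hM : IsRegularKernel M)
    {f : ℕ → 𝓢(Rn n, ℂ)} {T : 𝓢'(Rn n, ℂ)}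
    (hf : Tendsto (fun s => regular (f s)) atTop (𝓝 T)) {v : ℕ → Rn n} {w : Rn n}
    (hv : Tendsto v atTop (𝓝 w))
    (hq : Tendsto (fun s => (v s).ofLp ⬝ᵥ (gram M (f s)).mulVec (v s).ofLp) atTop (𝓝 0))
    (ψ : 𝓢(Rn n, ℂ)) : T (innerMul w ψ) = 0 := by
  suffices h : (fun ψ => T (innerMul w (conjSchwartz n ψ))) = fun _ => 0 by
    have := congrFun h (conjSchwartz n ψ)
    simpa only [conjSchwartz_conjSchwartz] using this
  refine Continuous.ext_on hM.dense_range
    (T.continuous.comp ((innerMul w).continuous.comp (conjSchwartz n).continuous))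
    continuous_const ?_
  rintro χ ⟨φ, hφ, hχ⟩
  have hlim := tendsto_regular_innerMul hf hv (conjSchwartz n χ)
  refine tendsto_nhds_unique hlim ?_
  -- Cauchy–Schwarz: the square is at most the quadratic form at v s, which tends to 0, times the
  -- fixed energy of φ.
  have hsq : Tendsto (fun s => ‖regular (f s) (innerMul (v s) (conjSchwartz n χ))‖ ^ 2) atTop
      (𝓝 0) := by
    have hub := hq.mul_const (kernelPairing M φ φ).re
    rw [zero_mul] at hub
    refine squeeze_zero (fun _ => by positivity) (fun s => ?_) hub
    rw [regular_innerMul_conj M (f s) χ (v s) hχ, RCLike.norm_conj, hM.gram_quadratic,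
      hM.kernelForm_eq_kernelPairing (SchwartzMap.integrable _) (SchwartzMap.integrable _)]
    exact hM.norm_kernelPairing_sq_le ((innerMul (v s) (f s)).memLp 2) hφ
  have hn := (Real.continuous_sqrt.tendsto 0).comp hsq
  simp only [Function.comp_def, Real.sqrt_zero, Real.sqrt_sq (norm_nonneg _)] at hn
  exact tendsto_zero_iff_norm_tendsto_zero.2 hn

/-- A sequence of orthonormal bases has a subsequence converging to an orthonormal basis. -/
theorem exists_subseq_tendsto_orthonormalBasis (b : ℕ → OrthonormalBasis (Fin n) ℝ (Rn n)) :
    ∃ (B : OrthonormalBasis (Fin n) ℝ (Rn n)) (σ : ℕ → ℕ), StrictMono σ ∧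
      ∀ j, Tendsto (fun s => b (σ s) j) atTop (𝓝 (B j)) := by
  obtain ⟨v, -, σ, hσ, hlim⟩ := tendsto_subseq_of_bounded (x := fun s => fun j => b s j)
    (Metric.isBounded_closedBall (x := (0 : Fin n → Rn n)) (r := 1)) fun s => by
      rw [mem_closedBall_zero_iff, pi_norm_le_iff_of_nonneg zero_le_one]
      exact fun j => ((b s).orthonormal.1 j).le
  have hlim' : ∀ j, Tendsto (fun s => b (σ s) j) atTop (𝓝 (v j)) := tendsto_pi_nhds.1 hlim
  have hv : Orthonormal ℝ v := by
    rw [orthonormal_iff_ite]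
    intro i j
    refine tendsto_nhds_unique ((hlim' i).inner (hlim' j)) (tendsto_const_nhds.congr fun s => ?_)
    exact (orthonormal_iff_ite.1 (b (σ s)).orthonormal i j).symm
  obtain ⟨B, hB⟩ := Orthonormal.exists_orthonormalBasis_extension_of_card_eq
    (ι := Fin n) (by simp) (v := v) (s := Set.univ)
    (hv.comp _ Subtype.val_injective)
  exact ⟨B, σ, hσ, fun j => hB j trivial ▸ hlim' j⟩

/-- A tempered distribution annihilated by the linear functions vanishing on a `k`-dimensional
subspace is carried by this subspace. -/
theorem mem_G'_of_apply_innerMul_eq_zero {k : ℕ} (hk : k ≤ n) {T : 𝓢'(Rn n, ℂ)}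
    (B : OrthonormalBasis (Fin n) ℝ (Rn n))
    (hT : ∀ j : Fin n, k ≤ (j : ℕ) → ∀ ψ, T (innerMul (B j) ψ) = 0) : T ∈ G' hk := by
  -- The rotation by `B.repr.symm` turns the linear function ⟨B j, ·⟩ into the j-th coordinate.
  obtain ⟨g, hg⟩ := exists_eq_tensorDelta hk (rotate B.repr.symm T) fun j hj ψ => by
    rw [rotate_apply, ← hT j hj
      (SchwartzMap.compCLMOfContinuousLinearEquiv ℂ B.repr.toContinuousLinearEquiv ψ)]
    congr 1
    ext x
    rw [innerMul_apply]
    change innerMul (EuclideanSpace.single j 1) ψ (B.repr x) = _ * ψ (B.repr x)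
    rw [innerMul_apply, EuclideanSpace.inner_single_left, map_one, one_mul,
      B.repr_apply_apply]
  refine ⟨g, B.repr, ?_⟩
  rw [← hg]
  ext φ
  rw [rotate_apply, rotate_apply]
  congr 1
  ext x
  exact congrArg φ (B.repr.symm_apply_apply x).symm

theorem mem_G'_of_tendsto {k : ℕ} (hk : k ≤ n) {M : Rn n → Rn n → ℂ} (hM : IsRegularKernel M)
    {f : ℕ → 𝓢(Rn n, ℂ)} {T : 𝓢'(Rn n, ℂ)}
    (hf : Tendsto (fun s => regular (f s)) atTop (𝓝 T))
    (hR : Tendsto (fun s => R k hM.toIsKernel (f s)) atTop (𝓝 0)) : T ∈ G' hk := by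
  choose b hb using fun s => exists_basis_quadratic_le_antiNorm hk
    (gram_isHermitian hM.toIsKernel (f s)) (hM.quadratic_nonneg (f s))
  obtain ⟨B, σ, hσ, hB⟩ := exists_subseq_tendsto_orthonormalBasis b
  refine mem_G'_of_apply_innerMul_eq_zero hk B fun j hj => ?_
  exact apply_innerMul_eq_zero_of_tendsto hM (hf.comp hσ.tendsto_atTop) (hB j)
    (squeeze_zero (fun s => hM.quadratic_nonneg _ _) (fun s => hb (σ s) j hj)
      (hR.comp hσ.tendsto_atTop))

end Limit

/-! ### Approximation of distributions carried by subspaces -/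

section Approximation

variable {k n : ℕ}

/-- No integrability is assumed, so the same formula serves for pairings and for L¹ norms. -/
theorem integral_abs_det_comp (L : Rn n ≃L[ℝ] Rn n) {F : Type*} [NormedAddCommGroup F]
    [NormedSpace ℝ F] (g : Rn n → F) :
    ∫ x, |(L : Rn n →L[ℝ] Rn n).det| • g (L x) = ∫ x, g x := by
  have := integral_image_eq_integral_abs_det_fderiv_smul volume MeasurableSet.univ
    (f := L) (f' := fun _ => (L : Rn n →L[ℝ] Rn n))
    (fun x _ => L.hasFDerivAt.hasFDerivWithinAt) L.injective.injOn g
  rw [Set.image_univ, L.surjective.range_eq, setIntegral_univ, setIntegral_univ] at this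
  exact this.symm

/-- The dilation by `s` of the last `n - k` coordinates. -/
noncomputable def dilation (hk : k ≤ n) (s : ℝ) : Rn n →L[ℝ] Rn n :=
  (padZero hk).toContinuousLinearMap.comp (head hk) +
    s • (ContinuousLinearMap.id ℝ (Rn n) -
      (padZero hk).toContinuousLinearMap.comp (head hk))

theorem dilation_apply (hk : k ≤ n) (s : ℝ) (x : Rn n) :
    dilation hk s x = padZero hk (head hk x) + s • (x - padZero hk (head hk x)) := rfl

theorem dilation_coord (hk : k ≤ n) (s : ℝ) (x : Rn n) (i : Fin n) :
    dilation hk s x i = if (i : ℕ) < k then x i else s * x i := by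
  rw [dilation_apply]
  simp only [PiLp.add_apply, PiLp.smul_apply, PiLp.sub_apply, padZero_head_apply, smul_eq_mul]
  split_ifs <;> ring

/-- The dilation by `s ≠ 0` of the last `n - k` coordinates, as an isomorphism. -/
noncomputable def dilationEquiv (hk : k ≤ n) {s : ℝ} (hs : s ≠ 0) : Rn n ≃L[ℝ] Rn n :=
  ContinuousLinearEquiv.equivOfInverse (dilation hk s) (dilation hk s⁻¹)
    (fun x => by ext i; simp only [dilation_coord]; split_ifs <;> field_simp)
    (fun x => by ext i; simp only [dilation_coord]; split_ifs <;> field_simp)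

/-- The Schwartz function `|det L| F(L x)`. -/
noncomputable def scaled (L : Rn n ≃L[ℝ] Rn n) (F : 𝓢(Rn n, ℂ)) : 𝓢(Rn n, ℂ) :=
  |(L : Rn n →L[ℝ] Rn n).det| • SchwartzMap.compCLMOfContinuousLinearEquiv ℂ L F

theorem scaled_apply (L : Rn n ≃L[ℝ] Rn n) (F : 𝓢(Rn n, ℂ)) (x : Rn n) :
    scaled L F x = |(L : Rn n →L[ℝ] Rn n).det| • F (L x) := rfl

theorem regular_scaled_apply (L : Rn n ≃L[ℝ] Rn n) (F φ : 𝓢(Rn n, ℂ)) :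
    regular (scaled L F) φ = ∫ w, φ (L.symm w) * F w := by
  rw [regular_apply, ← integral_abs_det_comp L fun w => φ (L.symm w) * F w]
  congr 1; ext x
  rw [scaled_apply, L.symm_apply_apply, mul_smul_comm]

/-- The approximations `|det| F(D_s U x)` of a distribution carried by a subspace. -/
noncomputable def squeezed (hk : k ≤ n) (U : Rn n ≃ₗᵢ[ℝ] Rn n) (F : 𝓢(Rn n, ℂ)) (s : ℕ) :
    𝓢(Rn n, ℂ) :=
  -- The factor s + 1 keeps the dilation invertible at s = 0.
  scaled (U.toContinuousLinearEquiv.trans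
    (dilationEquiv hk (s := (s : ℝ) + 1) (by positivity))) F

theorem tendsto_regular_squeezed (hk : k ≤ n) (U : Rn n ≃ₗᵢ[ℝ] Rn n) (F φ : 𝓢(Rn n, ℂ)) :
    Tendsto (fun s => regular (squeezed hk U F s) φ) atTop
      (𝓝 (∫ w, φ (U.symm (padZero hk (head hk w))) * F w)) := by
  simp only [squeezed, regular_scaled_apply]
  refine tendsto_integral_of_dominated_convergence
    (fun w => SchwartzMap.seminorm ℝ 0 0 φ * ‖F w‖) (fun s => ?_)
    (F.integrable.norm.const_mul _) (fun s => Eventually.of_forall fun w => ?_)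
    (Eventually.of_forall fun w => ?_)
  · exact ((φ.continuous.comp (ContinuousLinearEquiv.continuous _)).mul
      F.continuous).aestronglyMeasurable
  · rw [norm_mul]
    gcongr
    exact φ.norm_le_seminorm ℝ _
  · refine Tendsto.mul_const _ ((φ.continuous.tendsto _).comp
      ((U.symm.continuous.tendsto _).comp ?_))
    -- The change of variables has moved the inverse dilation onto the test function; it contracts
    -- the last coordinates to 0.
    change Tendsto (fun s : ℕ => dilation hk ((s : ℝ) + 1)⁻¹ w) atTop _
    simp only [dilation_apply]
    have h0 : Tendsto (fun s : ℕ => ((s : ℝ) + 1)⁻¹) atTop (𝓝 0) := by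
      simpa using tendsto_one_div_add_atTop_nhds_zero_nat (𝕜 := ℝ)
    simpa using (h0.smul_const (w - padZero hk (head hk w))).const_add (padZero hk (head hk w))

/-- In a squeezed direction the coordinate of x is (s + 1)⁻¹ times that of L x, while the factor
|det L| is absorbed by the change of variables. -/
theorem integral_norm_innerMul_squeezed (hk : k ≤ n) (U : Rn n ≃ₗᵢ[ℝ] Rn n) (F : 𝓢(Rn n, ℂ))
    (s : ℕ) (j : Fin n) (hj : k ≤ (j : ℕ)) :
    ∫ x, ‖innerMul (U.symm (EuclideanSpace.single j 1)) (squeezed hk U F s) x‖ =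
      ((s : ℝ) + 1)⁻¹ * ∫ x, ‖innerMul (EuclideanSpace.single j 1) F x‖ := by
  set L := U.toContinuousLinearEquiv.trans
    (dilationEquiv hk (s := (s : ℝ) + 1) (by positivity)) with hL
  rw [← integral_abs_det_comp L fun x => ‖innerMul (EuclideanSpace.single j 1) F x‖,
    ← integral_const_mul]
  congr 1; ext x
  have hLx : L x j = ((s : ℝ) + 1) * U x j := by
    change dilation hk ((s : ℝ) + 1) (U x) j = _
    rw [dilation_coord, if_neg (not_lt.2 hj)]
  have hin : inner ℝ (U.symm (EuclideanSpace.single j 1)) x = U x j := by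
    rw [← U.inner_map_map, U.apply_symm_apply, EuclideanSpace.inner_single_left, map_one, one_mul]
  rw [innerMul_apply, innerMul_apply, hin, squeezed, scaled_apply, ← hL,
    EuclideanSpace.inner_single_left, map_one, one_mul, hLx]
  have hs : (0 : ℝ) < (s : ℝ) + 1 := by positivity
  simp only [norm_mul, norm_smul, Complex.norm_real, Real.norm_eq_abs, abs_abs, smul_eq_mul,
    abs_of_pos hs]
  field_simp

theorem eventually_R_squeezed_le (hk : k ≤ n) {M : Rn n → Rn n → ℂ} (hM : IsRegularKernel M)
    (U : Rn n ≃ₗᵢ[ℝ] Rn n) (F : 𝓢(Rn n, ℂ)) {ε : ℝ} (hε : 0 < ε) :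
    ∀ᶠ s in atTop, R k hM.toIsKernel (squeezed hk U F s) ≤ ε := by
  obtain ⟨γ, hγ⟩ := hM.bounded
  set C : Fin n → ℝ := fun j => ∫ x, ‖innerMul (EuclideanSpace.single j 1) F x‖
  have hbound : ∀ s, R k hM.toIsKernel (squeezed hk U F s) ≤
      ∑ j : Fin n, if k ≤ (j : ℕ) then
        γ * ((((s : ℝ) + 1)⁻¹ * C j) * (((s : ℝ) + 1)⁻¹ * C j)) else 0 := fun s => by
    -- Ky Fan's principle is tested on the basis U⁻¹e_j, whose last n - k vectors are the squeezed
    -- directions.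
    refine (antiNorm_le_sum_quadratic hk _
      ((EuclideanSpace.basisFun (Fin n) ℝ).map U.symm)).trans (Finset.sum_le_sum fun j _ => ?_)
    split_ifs with hj
    · rw [OrthonormalBasis.map_apply, EuclideanSpace.basisFun_apply, hM.gram_quadratic]
      refine (Complex.re_le_norm _).trans ((IsRegularKernel.norm_kernelForm_le hγ
        (SchwartzMap.integrable _) (SchwartzMap.integrable _)).trans_eq ?_)
      rw [integral_norm_innerMul_squeezed hk U F s j hj]
    · exact le_rfl
  have h0 : Tendsto (fun s : ℕ => ((s : ℝ) + 1)⁻¹) atTop (𝓝 0) := by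
    simpa using tendsto_one_div_add_atTop_nhds_zero_nat (𝕜 := ℝ)
  have hlim : Tendsto (fun s : ℕ => ∑ j : Fin n, if k ≤ (j : ℕ) then
      γ * ((((s : ℝ) + 1)⁻¹ * C j) * (((s : ℝ) + 1)⁻¹ * C j)) else 0) atTop (𝓝 0) := by
    rw [← Finset.sum_const_zero (ι := Fin n) (s := Finset.univ)]
    refine tendsto_finsetSum _ fun j _ => ?_
    by_cases hj : k ≤ (j : ℕ)
    · simpa [hj] using ((h0.mul_const (C j)).mul (h0.mul_const (C j))).const_mul γ
    · simp [hj]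
  filter_upwards [hlim.eventually_le_const hε] with s hs
  exact (hbound s).trans hs

theorem G_subset_seqClosure (hk : k ≤ n) {M : Rn n → Rn n → ℂ} (hM : IsRegularKernel M)
    {ε : ℝ} (hε : 0 < ε) : G hk ⊆ seqClosure (regular '' Omega k hM.toIsKernel ε) := by
  rintro T ⟨f, U, rfl⟩
  have h : k + (n - k) = n := Nat.add_sub_cancel' hk
  set c : ℂ := ∫ x, bump (n - k) x
  have hc : c ≠ 0 := integral_bump_ne_zero (n - k)
  -- Dividing by the integral of the bump makes the marginal of F on ℝᵏ equal to f.
  set F := c⁻¹ • extend h f with hF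
  obtain ⟨N, hN⟩ := eventually_atTop.1 (eventually_R_squeezed_le hk hM U F hε)
  -- The bound on R holds only from N on, so the sequence is shifted to lie in Ω_ε from the start.
  refine ⟨fun s => regular (squeezed hk U F (s + N)),
    fun s => ⟨_, hN _ (Nat.le_add_left N s), rfl⟩, ?_⟩
  rw [tendsto_add_atTop_iff_nat (f := fun s => regular (squeezed hk U F s)) N,
    PointwiseConvergenceCLM.tendsto_iff_forall_tendsto]
  intro φ
  convert tendsto_regular_squeezed hk U F φ using 2
  rw [rotate_apply, tensorDelta_apply, regular_apply]
  have hsplit := integral_head_mul_tail h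
    (fun x => φ (U.symm (padZero hk x)) * f x) (bump (n - k))
  have hint : ∀ w, φ (U.symm (padZero hk (head hk w))) * F w =
      c⁻¹ * (φ (U.symm (padZero hk (head hk w))) * f (head hk w) * bump (n - k) (tail h w)) :=
    fun w => by
      rw [hF, smul_apply, extend_apply, smul_eq_mul]
      ring
  simp_rw [hint]
  rw [integral_const_mul, hsplit, mul_comm, mul_assoc, mul_inv_cancel₀ hc, mul_one]
  rfl

end Approximation

end LowDim

theorem theorem4 {n k : ℕ} (hk : k ≤ n) {M : LowDim.Rn n → LowDim.Rn n → ℂ}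
    (hM : LowDim.IsRegularKernel M) :
    (∀ ε : ℝ, 0 < ε →
      LowDim.G hk ⊆ seqClosure (LowDim.regular '' LowDim.Omega k hM.toIsKernel ε)) ∧
    (∀ (f : ℕ → 𝓢(LowDim.Rn n, ℂ)) (T : 𝓢'(LowDim.Rn n, ℂ)),
      Tendsto (fun s => LowDim.regular (f s)) atTop (𝓝 T) →
      Tendsto (fun s => LowDim.R k hM.toIsKernel (f s)) atTop (𝓝 0) →
      (∃ C : ℝ, ∀ s, |(LowDim.gram M (f s)).trace| ≤ C) →
      T ∈ LowDim.G' hk) :=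
  ⟨fun _ hε => LowDim.G_subset_seqClosure hk hM hε,
    fun _ _ hf hR _ => LowDim.mem_G'_of_tendsto hk hM hf hR⟩
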